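/- For a function $p:\mathbb R\to\mathbb R$ let $$\|p\|_{\rm TV}=\sup\sum_{k=1}^n|p(x_k)-p(x_{k-1})|,$$ the supremum being over all finite collections $x_0<x_1<\dots<x_n$ of real numbers. For a real random variable $X$ whose distribution has an absolutely continuous density $p$ with respect to Lebesgue measure (absolutely continuous on every compact interval), its Fisher information is $$I(X)=\int_{\{p>0\}}\frac{p'(x)^2}{p(x)}\,dx\in[0,\infty],$$ where $p'$ is the almost everywhere defined derivative of $p$; in all other cases $I(X)=+\infty$. Let $X_1,X_2,X_3$ be independent real random variables having densities $p_1,p_2,p_3$ (non-negative measurable functions) with $\|p_i\|_{\rm TV}<\infty$ for $i=1,2,3$. Then $S=X_1+X_2+X_3$ has finite Fisher information, and moreover $$I(S)\le\frac12\Big[\|p_1\|_{\rm TV}\|p_2\|_{\rm TV}+\|p_1\|_{\rm TV}\|p_3\|_{\rm TV}+\|p_2\|_{\rm TV}\|p_3\|_{\rm TV}\Big].$$ -/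

import Mathlib

open MeasureTheory ProbabilityTheory
open scoped ENNReal

/-- `p` is a (version of the) density of the measure `ν` on the line with respect to
Lebesgue measure. -/
structure IsDensity (ν : Measure ℝ) (p : ℝ → ℝ) : Prop where
  measurable : Measurable p
  nonneg : ∀ x, 0 ≤ p x
  eq_withDensity : ν = volume.withDensity fun x => ENNReal.ofReal (p x)

/-- `p` is absolutely continuous on every compact interval. -/
def IsAbsCont (p : ℝ → ℝ) : Prop :=
  ∀ a b : ℝ, AbsolutelyContinuousOnInterval p a b

/-- The integral of `p'(x)² / p(x)` over the set where `p` is positive. The derivative of an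
absolutely continuous function exists almost everywhere. -/
noncomputable def fisherIntegral (p : ℝ → ℝ) : ℝ≥0∞ :=
  ∫⁻ x in {x | 0 < p x}, ENNReal.ofReal (deriv p x ^ 2 / p x)

/-- Fisher information of a measure on the line: the Fisher integral of its absolutely continuous
density if there is one, and `∞` (the infimum of the empty set) otherwise. There is at most one
such density, see `fisherInfo_eq`. -/
noncomputable def fisherInfo (ν : Measure ℝ) : ℝ≥0∞ :=
  ⨅ (p : ℝ → ℝ) (_ : IsDensity ν p) (_ : IsAbsCont p), fisherIntegral p

/-- Total variation over the real line: the supremum of `∑ |p (x_k) - p (x_{k-1})|`. -/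
noncomputable def tvNorm (p : ℝ → ℝ) : ℝ≥0∞ :=
  eVariationOn p Set.univ

theorem IsAbsCont.continuous {p : ℝ → ℝ} (hp : IsAbsCont p) : Continuous p := by
  rw [continuous_iff_continuousAt]
  intro x
  refine (hp (x - 1) (x + 1)).continuousOn.continuousAt ?_
  rw [Set.uIcc_of_le (by linarith)]
  exact Icc_mem_nhds (by linarith) (by linarith)

theorem IsDensity.eq_of_isAbsCont {ν : Measure ℝ} [IsFiniteMeasure ν] {p q : ℝ → ℝ}
    (hp : IsDensity ν p) (hq : IsDensity ν q) (hpc : IsAbsCont p) (hqc : IsAbsCont q) :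
    p = q := by
  have h : (fun x => ENNReal.ofReal (p x)) =ᵐ[volume] fun x => ENNReal.ofReal (q x) := by
    refine (withDensity_eq_iff hp.measurable.ennreal_ofReal.aemeasurable
      hq.measurable.ennreal_ofReal.aemeasurable ?_).1 (hp.eq_withDensity ▸ hq.eq_withDensity)
    have h1 := measure_ne_top ν Set.univ
    rwa [hp.eq_withDensity, withDensity_apply _ MeasurableSet.univ,
      Measure.restrict_univ] at h1
  have h2 : p =ᵐ[volume] q := by
    filter_upwards [h] with x hx
    exact (ENNReal.ofReal_eq_ofReal_iff (hp.nonneg x) (hq.nonneg x)).1 hx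
  exact (Continuous.ae_eq_iff_eq volume hpc.continuous hqc.continuous).1 h2

theorem fisherInfo_eq {ν : Measure ℝ} [IsFiniteMeasure ν] {p : ℝ → ℝ}
    (hp : IsDensity ν p) (hpc : IsAbsCont p) : fisherInfo ν = fisherIntegral p := by
  refine le_antisymm (iInf_le_of_le p (iInf_le_of_le hp (iInf_le _ hpc))) ?_
  refine le_iInf fun q => le_iInf fun hq => le_iInf fun hqc => ?_
  rw [hp.eq_of_isAbsCont hq hpc hqc]

/-!
A non-negative integrable function `p` of bounded variation is a difference `F - G` of monotone
functions with `0 ≤ G` and `F ≤ ‖p‖_TV / 2`. Hence `p` is the integral over `0 < s ≤ ‖p‖_TV / 2` of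
the indicator functions of the sets `{G < s ≤ F}`, and these sets are intervals. Convolution is
multilinear and the Fisher information is convex, so it suffices to bound the Fisher integral of
`f = 1_I ∗ 1_J ∗ 1_K` for bounded intervals. If `I` has endpoints `a ≤ b`, then
`f' x = h (x - a) - h (x - b)`, where `h = 1_J ∗ 1_K` is non-negative and 1-Lipschitz. Therefore
`f' x ^ 2 ≤ |h (x - a) ^ 2 - h (x - b) ^ 2| ≤ 2 ∫ h`, the integral being over `[x - b, x - a]`,
that is, `f' ^ 2 ≤ 2 f`, and the Fisher integral of `f` is at most twice the length
`|I| + |J| + |K|` of its support. Integrating this over the parameters `s` of the three mixtures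
gives the bound.
-/

open Filter Topology

theorem fisherIntegral_eq_lintegral {p : ℝ → ℝ} (hp : ∀ x, 0 ≤ p x) :
    fisherIntegral p = ∫⁻ x, ENNReal.ofReal (deriv p x ^ 2 / p x) := by
  refine setLIntegral_eq_of_support_subset fun x hx => (hp x).lt_of_ne' fun h => hx ?_
  simp [h]

theorem fisherIntegral_le_mul_volume_support {p : ℝ → ℝ} {M : ℝ} (hp : ∀ x, 0 ≤ p x)
    (h : ∀ x, deriv p x ^ 2 ≤ M * p x) :
    fisherIntegral p ≤ ENNReal.ofReal M * volume (Function.support p) := by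
  have hsupp : {x | 0 < p x} = Function.support p :=
    Set.ext fun x => (hp x).lt_iff_ne'
  calc fisherIntegral p ≤ ∫⁻ _ in {x | 0 < p x}, ENNReal.ofReal M :=
        setLIntegral_mono measurable_const fun x hx =>
          ENNReal.ofReal_le_ofReal ((div_le_iff₀ hx).2 (h x))
    _ = ENNReal.ofReal M * volume (Function.support p) := by
        rw [setLIntegral_const, hsupp]

theorem ofReal_integral_le_lintegral_ofReal {α : Type*} [MeasurableSpace α] {μ : Measure α}
    (u : α → ℝ) : ENNReal.ofReal (∫ a, u a ∂μ) ≤ ∫⁻ a, ENNReal.ofReal (u a) ∂μ := by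
  by_cases hu : Integrable u μ
  · rw [integral_eq_lintegral_pos_part_sub_lintegral_neg_part hu]
    exact (ENNReal.ofReal_le_ofReal (sub_le_self _ ENNReal.toReal_nonneg)).trans
      ENNReal.ofReal_toReal_le
  · simp [integral_undef hu]

theorem two_mul_mul_sub_sq_mul_le_sq_div {u v : ℝ} (c : ℝ) (hv : 0 ≤ v) (huv : v = 0 → u = 0) :
    2 * c * u - c ^ 2 * v ≤ u ^ 2 / v := by
  rcases hv.eq_or_lt with rfl | hv
  · simp [huv rfl]
  · rw [le_div_iff₀ hv]
    linarith [sq_nonneg (u - c * v)]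

theorem ofReal_sq_integral_div_integral_le {α : Type*} [MeasurableSpace α] {μ : Measure α}
    {u v : α → ℝ} (hu : Integrable u μ) (hv : Integrable v μ) (hv0 : ∀ᵐ a ∂μ, 0 ≤ v a)
    (huv : ∀ᵐ a ∂μ, v a = 0 → u a = 0) :
    ENNReal.ofReal ((∫ a, u a ∂μ) ^ 2 / ∫ a, v a ∂μ) ≤
      ∫⁻ a, ENNReal.ofReal (u a ^ 2 / v a) ∂μ := by
  set U := ∫ a, u a ∂μ
  set V := ∫ a, v a ∂μ
  -- the tangent of the convex function `(u, v) ↦ u² / v` at `(U, V)` has slopes `2c` and `-c²`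
  set c := U / V
  have htangent : U ^ 2 / V = 2 * c * U - c ^ 2 * V := by
    rcases eq_or_ne V 0 with hV | hV
    · simp [c, hV]
    · have hU : c * V = U := div_mul_cancel₀ U hV
      rw [div_eq_iff hV, ← hU]
      ring
  have hmean : U ^ 2 / V = ∫ a, 2 * c * u a - c ^ 2 * v a ∂μ := by
    rw [integral_sub (hu.const_mul _) (hv.const_mul _), integral_const_mul, integral_const_mul,
      htangent]
  rw [hmean]
  refine (ofReal_integral_le_lintegral_ofReal _).trans (lintegral_mono_ae ?_)
  filter_upwards [hv0, huv] with a h0 h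
  exact ENNReal.ofReal_le_ofReal (two_mul_mul_sub_sq_mul_le_sq_div c h0 h)

theorem aemeasurable_deriv_of_uncurry {α : Type*} [MeasurableSpace α] {μ : Measure α}
    {f : α → ℝ → ℝ} {t : α → ℝ} (hf : Measurable f.uncurry) (ht : Measurable t)
    (hd : ∀ᵐ a ∂μ, DifferentiableAt ℝ (f a) (t a)) :
    AEMeasurable (fun a => deriv (f a) (t a)) μ := by
  refine aemeasurable_of_tendsto_metrizable_ae (𝓝[≠] (0 : ℝ))
    (f := fun h a => h⁻¹ • (f a (t a + h) - f a (t a))) (fun h => ?_)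
    (hd.mono fun a ha => ha.hasDerivAt.tendsto_slope_zero)
  exact (((hf.comp (measurable_id.prodMk (ht.add_const h))).sub
    (hf.comp (measurable_id.prodMk ht))).const_smul h⁻¹).aemeasurable

section Mixture

variable {α : Type*} [MeasurableSpace α] {μ : Measure α} {f : α → ℝ → ℝ} {C : α → NNReal}

theorem hasDerivAt_integral_of_lipschitzWith (hf : Measurable f.uncurry)
    (hint : ∀ x, Integrable (f · x) μ) (hlip : ∀ᵐ a ∂μ, LipschitzWith (C a) (f a))
    (hC : Integrable (fun a => (C a : ℝ)) μ) (hd : ∀ᵐ a ∂μ, Differentiable ℝ (f a)) (x : ℝ) :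
    Integrable (fun a => deriv (f a) x) μ ∧
      HasDerivAt (fun x => ∫ a, f a x ∂μ) (∫ a, deriv (f a) x ∂μ) x := by
  refine hasDerivAt_integral_of_dominated_loc_of_lip univ_mem
    (Eventually.of_forall fun y => (hint y).aestronglyMeasurable) (hint x)
    (aemeasurable_deriv_of_uncurry hf measurable_const
      (hd.mono fun a ha => ha x)).aestronglyMeasurable ?_ hC (hd.mono fun a ha => (ha x).hasDerivAt)
  filter_upwards [hlip] with a ha
  simpa using ha

theorem lipschitzWith_integral (hint : ∀ x, Integrable (f · x) μ)
    (hlip : ∀ᵐ a ∂μ, LipschitzWith (C a) (f a)) (hC : Integrable (fun a => (C a : ℝ)) μ) :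
    LipschitzWith (∫ a, (C a : ℝ) ∂μ).toNNReal (fun x => ∫ a, f a x ∂μ) := by
  refine LipschitzWith.of_dist_le' fun x y => ?_
  rw [dist_eq_norm, ← integral_sub (hint x) (hint y), ← integral_mul_const]
  refine norm_integral_le_of_norm_le (hC.mul_const _) ?_
  filter_upwards [hlip] with a ha
  rw [← dist_eq_norm]
  exact ha.dist_le_mul x y

theorem fisherIntegral_integral_le [SFinite μ] (hf : Measurable f.uncurry) (h0 : ∀ a x, 0 ≤ f a x)
    (hint : ∀ x, Integrable (f · x) μ) (hlip : ∀ᵐ a ∂μ, LipschitzWith (C a) (f a))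
    (hC : Integrable (fun a => (C a : ℝ)) μ) (hd : ∀ᵐ a ∂μ, Differentiable ℝ (f a)) :
    fisherIntegral (fun x => ∫ a, f a x ∂μ) ≤ ∫⁻ a, fisherIntegral (f a) ∂μ := by
  have hderiv := hasDerivAt_integral_of_lipschitzWith hf hint hlip hC hd
  have hmeas : AEMeasurable (fun z : α × ℝ => ENNReal.ofReal (deriv (f z.1) z.2 ^ 2 / f z.1 z.2))
      (μ.prod volume) := by
    have hd' := (Measure.quasiMeasurePreserving_fst (ν := (volume : Measure ℝ))).ae hd
    have := aemeasurable_deriv_of_uncurry (f := fun z : α × ℝ => f z.1) (t := Prod.snd)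
      (hf.comp (measurable_fst.fst.prodMk measurable_snd)) measurable_snd
      (hd'.mono fun z hz => hz z.2)
    exact ((this.pow_const 2).div hf.aemeasurable).ennreal_ofReal
  have hpoint : ∀ x, ENNReal.ofReal (deriv (fun x => ∫ a, f a x ∂μ) x ^ 2 / ∫ a, f a x ∂μ) ≤
      ∫⁻ a, ENNReal.ofReal (deriv (f a) x ^ 2 / f a x) ∂μ := fun x => by
    rw [(hderiv x).2.deriv]
    refine ofReal_sq_integral_div_integral_le (hderiv x).1 (hint x)
      (Eventually.of_forall fun a => h0 a x) (Eventually.of_forall fun a ha => ?_)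
    -- where `f a` vanishes it has a minimum
    exact IsLocalMin.deriv_eq_zero (Eventually.of_forall fun y => ha ▸ h0 a y)
  calc fisherIntegral (fun x => ∫ a, f a x ∂μ)
      = ∫⁻ x, ENNReal.ofReal (deriv (fun x => ∫ a, f a x ∂μ) x ^ 2 / ∫ a, f a x ∂μ) :=
        fisherIntegral_eq_lintegral fun x => integral_nonneg fun a => h0 a x
    _ ≤ ∫⁻ x, ∫⁻ a, ENNReal.ofReal (deriv (f a) x ^ 2 / f a x) ∂μ := lintegral_mono hpoint
    _ = ∫⁻ a, (∫⁻ x, ENNReal.ofReal (deriv (f a) x ^ 2 / f a x)) ∂μ :=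
        (lintegral_lintegral_swap hmeas).symm
    _ = ∫⁻ a, fisherIntegral (f a) ∂μ :=
        lintegral_congr fun a => (fisherIntegral_eq_lintegral (h0 a)).symm

end Mixture

theorem IsAbsCont.of_lipschitzWith {p : ℝ → ℝ} {K : NNReal} (hp : LipschitzWith K p) :
    IsAbsCont p :=
  fun _ _ => hp.lipschitzOnWith.absolutelyContinuousOnInterval

theorem sq_sub_le_two_mul_integral {φ : ℝ → ℝ} {K : NNReal} (hφ : LipschitzWith K φ)
    (h0 : ∀ x, 0 ≤ φ x) {x y : ℝ} (hxy : x ≤ y) :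
    (φ y - φ x) ^ 2 ≤ 2 * K * ∫ t in x..y, φ t := by
  have hac := IsAbsCont.of_lipschitzWith hφ x y
  calc (φ y - φ x) ^ 2 ≤ |φ y * φ y - φ x * φ x| := by
        rw [mul_self_sub_mul_self, abs_mul, ← sq_abs, sq,
          abs_of_nonneg (add_nonneg (h0 y) (h0 x))]
        gcongr
        exact abs_sub_le_of_nonneg_of_le (h0 y) (by linarith [h0 x]) (h0 x) (by linarith [h0 y])
    _ = ‖∫ t in x..y, deriv φ t * φ t + φ t * deriv φ t‖ := by
        rw [hac.integral_deriv_mul_eq_sub hac, Real.norm_eq_abs]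
    _ ≤ ∫ t in x..y, 2 * K * φ t := by
        refine intervalIntegral.norm_integral_le_of_norm_le hxy
          (Eventually.of_forall fun t _ => ?_)
          ((hφ.continuous.const_mul _).intervalIntegrable x y)
        have hd : ‖deriv φ t‖ ≤ K := norm_deriv_le_of_lipschitz hφ
        rw [mul_comm (φ t), ← two_mul, ← mul_assoc, norm_mul, norm_mul, Real.norm_two,
          Real.norm_of_nonneg (h0 t)]
        gcongr
        exact h0 t
    _ = 2 * K * ∫ t in x..y, φ t := intervalIntegral.integral_const_mul _ _

/-- The convolution of `φ` with the indicator function of `(a, b]`, as an integral of `φ` over a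
moving window. -/
noncomputable def intervalConv (a b : ℝ) (φ : ℝ → ℝ) (x : ℝ) : ℝ :=
  ∫ t in (x - b)..(x - a), φ t

section IntervalConv

variable {a b M : ℝ} {φ : ℝ → ℝ}

theorem intervalConv_nonneg (hab : a ≤ b) (h0 : ∀ x, 0 ≤ φ x) (x : ℝ) :
    0 ≤ intervalConv a b φ x :=
  intervalIntegral.integral_nonneg_of_forall (by linarith) h0

theorem intervalIntegral_le_mul_sub (hφ : ∀ a b, IntervalIntegrable φ volume a b)
    (hM : ∀ x, φ x ≤ M) (hab : a ≤ b) : ∫ t in a..b, φ t ≤ M * (b - a) := by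
  calc ∫ t in a..b, φ t ≤ ∫ _ in a..b, M :=
        intervalIntegral.integral_mono hab (hφ a b) intervalIntegrable_const hM
    _ = M * (b - a) := by simp [mul_comm]

theorem intervalConv_le (hφ : ∀ a b, IntervalIntegrable φ volume a b) (hM : ∀ x, φ x ≤ M)
    (hab : a ≤ b) (x : ℝ) : intervalConv a b φ x ≤ M * (b - a) :=
  (intervalIntegral_le_mul_sub hφ hM (by linarith)).trans_eq (by ring)

theorem intervalConv_sub (hφ : ∀ a b, IntervalIntegrable φ volume a b) (x y : ℝ) :
    intervalConv a b φ y - intervalConv a b φ x =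
      (∫ t in (x - a)..(y - a), φ t) - ∫ t in (x - b)..(y - b), φ t := by
  simp only [intervalConv]
  rw [intervalIntegral.integral_interval_sub_interval_comm (hφ _ _) (hφ _ _) (hφ _ _),
    intervalIntegral.integral_symm (y - b), intervalIntegral.integral_symm (y - a)]
  ring

theorem lipschitzWith_intervalConv {K : NNReal} (hφ : ∀ a b, IntervalIntegrable φ volume a b)
    (h0 : ∀ x, 0 ≤ φ x) (hK : ∀ x, φ x ≤ K) : LipschitzWith K (intervalConv a b φ) := by
  refine LipschitzWith.of_le_add_mul K fun y x => ?_
  suffices |intervalConv a b φ y - intervalConv a b φ x| ≤ K * dist y x by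
    linarith [le_abs_self (intervalConv a b φ y - intervalConv a b φ x)]
  wlog hxy : x ≤ y generalizing x y
  · rw [abs_sub_comm, dist_comm]
    exact this x y (le_of_not_ge hxy)
  have hwindow : ∀ c, ∫ t in (x - c)..(y - c), φ t ∈ Set.Icc 0 (K * (y - x)) := fun c =>
    ⟨intervalIntegral.integral_nonneg_of_forall (by linarith) h0,
      (intervalIntegral_le_mul_sub hφ hK (by linarith)).trans_eq (by ring)⟩
  rw [intervalConv_sub hφ, Real.dist_eq, abs_of_nonneg (sub_nonneg.2 hxy)]
  exact abs_sub_le_of_nonneg_of_le (hwindow a).1 (hwindow a).2 (hwindow b).1 (hwindow b).2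

theorem hasDerivAt_intervalConv (hφ : Continuous φ) (x : ℝ) :
    HasDerivAt (intervalConv a b φ) (φ (x - a) - φ (x - b)) x := by
  have hprim : ∀ c, HasDerivAt (fun y => ∫ t in (0 : ℝ)..(y - c), φ t) (φ (x - c)) x := fun c =>
    (hφ.integral_hasStrictDerivAt 0 (x - c)).hasDerivAt.comp_sub_const x c
  refine ((hprim a).sub (hprim b)).congr_of_eventuallyEq (Eventually.of_forall fun y => ?_)
  exact (intervalIntegral.integral_interval_sub_left (hφ.intervalIntegrable _ _)
    (hφ.intervalIntegrable _ _)).symm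

theorem support_intervalConv_subset {c d : ℝ} (hab : a ≤ b)
    (hφ : Function.support φ ⊆ Set.Ioc c d) :
    Function.support (intervalConv a b φ) ⊆ Set.Ioc (a + c) (b + d) := by
  refine fun x => not_imp_comm.1 fun hx => ?_
  rw [intervalConv, intervalIntegral.integral_of_le (by linarith)]
  refine setIntegral_eq_zero_of_forall_eq_zero fun t ht => not_not.1 fun h => hx ?_
  have := hφ h
  constructor <;> linarith [this.1, this.2, ht.1, ht.2]

theorem deriv_intervalConv_sq_le {K : NNReal} (hφ : LipschitzWith K φ) (h0 : ∀ x, 0 ≤ φ x)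
    (hab : a ≤ b) (x : ℝ) :
    deriv (intervalConv a b φ) x ^ 2 ≤ 2 * K * intervalConv a b φ x := by
  rw [(hasDerivAt_intervalConv hφ.continuous x).deriv]
  exact sq_sub_le_two_mul_integral hφ h0 (by linarith)

theorem indicator_Ioc_lconvolution (hab : a ≤ b) (hφ : ∀ a b, IntervalIntegrable φ volume a b)
    (h0 : ∀ x, 0 ≤ φ x) (x : ℝ) :
    ((Set.Ioc a b).indicator 1 ⋆ₗ fun x => ENNReal.ofReal (φ x)) x =
      ENNReal.ofReal (intervalConv a b φ x) := by
  have hint : IntegrableOn (fun y => φ (x - y)) (Set.Ioc a b) := by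
    refine (intervalIntegrable_iff_integrableOn_Ioc_of_le hab).1 ?_
    simpa using (hφ (x - a) (x - b)).comp_sub_left x
  calc ((Set.Ioc a b).indicator 1 ⋆ₗ fun x => ENNReal.ofReal (φ x)) x
      = ∫⁻ y in Set.Ioc a b, ENNReal.ofReal (φ (x - y)) := by
        rw [lconvolution_def, ← lintegral_indicator measurableSet_Ioc]
        refine lintegral_congr fun y => ?_
        by_cases hy : y ∈ Set.Ioc a b <;> simp [hy, sub_eq_neg_add]
    _ = ENNReal.ofReal (intervalConv a b φ x) := by
        rw [← ofReal_integral_eq_lintegral_ofReal hint (Eventually.of_forall fun y => h0 _),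
          ← intervalIntegral.integral_of_le hab, intervalIntegral.integral_comp_sub_left]
        rfl

end IntervalConv

section LConvolution

variable {G : Type*} [AddCommGroup G] [MeasurableSpace G] {ρ : Measure G}

theorem lconvolution_le_lintegral_mul {φ ψ : G → ℝ≥0∞} {c : ℝ≥0∞} (hφ : Measurable φ)
    (hψ : ∀ x, ψ x ≤ c) (x : G) : (φ ⋆ₗ[ρ] ψ) x ≤ (∫⁻ y, φ y ∂ρ) * c := by
  rw [lconvolution_def, ← lintegral_mul_const _ hφ]
  gcongr
  exact hψ _

variable [MeasurableAdd₂ G] [MeasurableNeg G]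

theorem lconvolution_congr_ae [ρ.IsAddLeftInvariant] [ρ.IsNegInvariant] {φ φ' ψ ψ' : G → ℝ≥0∞}
    (hφ : φ =ᵐ[ρ] φ') (hψ : ψ =ᵐ[ρ] ψ') : φ ⋆ₗ[ρ] ψ = φ' ⋆ₗ[ρ] ψ' := by
  ext x
  refine lintegral_congr_ae ?_
  have hψx := (Measure.measurePreserving_sub_left ρ x).quasiMeasurePreserving.ae_eq hψ
  filter_upwards [hφ, hψx] with y hy hxy
  rw [hy, neg_add_eq_sub]
  exact congrArg _ hxy

variable {α β : Type*} [MeasurableSpace α] [MeasurableSpace β] [SFinite ρ]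

theorem measurable_uncurry_lconvolution {φ ψ : α → G → ℝ≥0∞} (hφ : Measurable φ.uncurry)
    (hψ : Measurable ψ.uncurry) : Measurable (fun a => φ a ⋆ₗ[ρ] ψ a).uncurry := by
  have hmeas : Measurable fun z : (α × G) × G =>
      φ.uncurry (z.1.1, z.2) * ψ.uncurry (z.1.1, -z.2 + z.1.2) := by
    fun_prop
  exact hmeas.lintegral_prod_right'

theorem lintegral_lconvolution_lintegral {μ : Measure α} {ν : Measure β} [SFinite μ] [SFinite ν]
    {φ : α → G → ℝ≥0∞} {ψ : β → G → ℝ≥0∞} (hφ : Measurable φ.uncurry)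
    (hψ : Measurable ψ.uncurry) (x : G) :
    ((fun x => ∫⁻ a, φ a x ∂μ) ⋆ₗ[ρ] fun x => ∫⁻ b, ψ b x ∂ν) x =
      ∫⁻ z, (φ z.1 ⋆ₗ[ρ] ψ z.2) x ∂(μ.prod ν) := by
  have hmeas : Measurable fun z : G × α × β =>
      φ.uncurry (z.2.1, z.1) * ψ.uncurry (z.2.2, -z.1 + x) := by
    fun_prop
  calc ((fun x => ∫⁻ a, φ a x ∂μ) ⋆ₗ[ρ] fun x => ∫⁻ b, ψ b x ∂ν) x
      = ∫⁻ y, ∫⁻ z, φ z.1 y * ψ z.2 (-y + x) ∂(μ.prod ν) ∂ρ :=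
        lintegral_congr fun y => (lintegral_prod_mul hφ.of_uncurry_right.aemeasurable
          hψ.of_uncurry_right.aemeasurable).symm
    _ = ∫⁻ z, (φ z.1 ⋆ₗ[ρ] ψ z.2) x ∂(μ.prod ν) := lintegral_lintegral_swap hmeas.aemeasurable

end LConvolution

theorem exists_ae_eq_Ioc {S : Set ℝ} (hS : S.OrdConnected) (hfin : volume S ≠ ∞) :
    ∃ a b, a ≤ b ∧ S =ᵐ[volume] Set.Ioc a b := by
  suffices ∃ a b, S =ᵐ[volume] Set.Ioc a b by
    obtain ⟨a, b, h⟩ := this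
    rcases le_total a b with hab | hba
    · exact ⟨a, b, hab, h⟩
    · exact ⟨a, a, le_rfl, by simpa [Set.Ioc_eq_empty_of_le hba] using h⟩
  rcases hS.isPreconnected.mem_intervals with h | h | h | h | h | h | h | h | h | h
  · exact ⟨_, _, h ▸ Ioc_ae_eq_Icc.symm⟩
  · exact ⟨_, _, h ▸ Ico_ae_eq_Ioc⟩
  · exact ⟨_, _, h.eventuallyEq⟩
  · exact ⟨_, _, h ▸ Ioo_ae_eq_Ioc⟩
  iterate 5 · exact absurd (h ▸ by simp) hfin
  · exact ⟨0, 0, by simp [Set.mem_singleton_iff.1 h]⟩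

/-- The convolution of the indicator functions of three sets. -/
noncomputable def indicatorConv₃ (I J K : Set ℝ) (x : ℝ) : ℝ :=
  ((I.indicator 1 ⋆ₗ (J.indicator 1 ⋆ₗ K.indicator 1)) x).toReal

theorem indicatorConv₃_congr {I J K I' J' K' : Set ℝ} (hI : I =ᵐ[volume] I')
    (hJ : J =ᵐ[volume] J') (hK : K =ᵐ[volume] K') :
    indicatorConv₃ I J K = indicatorConv₃ I' J' K' := by
  unfold indicatorConv₃
  rw [lconvolution_congr_ae (indicator_ae_eq_of_ae_eq_set hJ) (indicator_ae_eq_of_ae_eq_set hK),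
    lconvolution_congr_ae (indicator_ae_eq_of_ae_eq_set hI) (ae_eq_refl _)]

theorem intervalIntegrable_indicator_Ioc (c d a b : ℝ) :
    IntervalIntegrable ((Set.Ioc c d).indicator (1 : ℝ → ℝ)) volume a b :=
  ((integrable_indicator_iff measurableSet_Ioc).2
    (integrableOn_const measure_Ioc_lt_top.ne)).intervalIntegrable

section IntervalTriple

variable {a₁ b₁ a₂ b₂ a₃ b₃ : ℝ}

theorem lipschitzWith_intervalConv_indicator :
    LipschitzWith 1 (intervalConv a₂ b₂ ((Set.Ioc a₃ b₃).indicator 1)) :=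
  lipschitzWith_intervalConv (intervalIntegrable_indicator_Ioc a₃ b₃)
    (Set.indicator_nonneg fun _ _ => zero_le_one)
    (Set.indicator_le_self' fun _ _ => zero_le_one)

theorem indicatorConv₃_Ioc (h₁ : a₁ ≤ b₁) (h₂ : a₂ ≤ b₂) :
    indicatorConv₃ (Set.Ioc a₁ b₁) (Set.Ioc a₂ b₂) (Set.Ioc a₃ b₃) =
      intervalConv a₁ b₁ (intervalConv a₂ b₂ ((Set.Ioc a₃ b₃).indicator 1)) := by
  have h0 : ∀ x, 0 ≤ (Set.Ioc a₃ b₃).indicator (1 : ℝ → ℝ) x :=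
    Set.indicator_nonneg fun _ _ => zero_le_one
  have hind : (Set.Ioc a₃ b₃).indicator (1 : ℝ → ℝ≥0∞) =
      fun x => ENNReal.ofReal ((Set.Ioc a₃ b₃).indicator 1 x) := by
    ext x
    by_cases hx : x ∈ Set.Ioc a₃ b₃ <;> simp [hx]
  have hinner := funext <|
    indicator_Ioc_lconvolution h₂ (intervalIntegrable_indicator_Ioc a₃ b₃) h0
  ext x
  rw [indicatorConv₃, hind, hinner, indicator_Ioc_lconvolution h₁
    (fun _ _ => lipschitzWith_intervalConv_indicator.continuous.intervalIntegrable _ _)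
    (intervalConv_nonneg h₂ h0),
    ENNReal.toReal_ofReal (intervalConv_nonneg h₁ (intervalConv_nonneg h₂ h0) x)]

end IntervalTriple

theorem indicatorConv₃_regularity {I J K : Set ℝ} (hI : I.OrdConnected) (hJ : J.OrdConnected)
    (hK : K.OrdConnected) (hIv : volume I ≠ ∞) (hJv : volume J ≠ ∞) (hKv : volume K ≠ ∞) :
    LipschitzWith (volume J).toNNReal (indicatorConv₃ I J K) ∧
      Differentiable ℝ (indicatorConv₃ I J K) ∧
      fisherIntegral (indicatorConv₃ I J K) ≤ 2 * (volume I + (volume J + volume K)) := by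
  obtain ⟨a₁, b₁, h₁, hI⟩ := exists_ae_eq_Ioc hI hIv
  obtain ⟨a₂, b₂, h₂, hJ⟩ := exists_ae_eq_Ioc hJ hJv
  obtain ⟨a₃, b₃, h₃, hK⟩ := exists_ae_eq_Ioc hK hKv
  rw [indicatorConv₃_congr hI hJ hK, measure_congr hI, measure_congr hJ, measure_congr hK,
    indicatorConv₃_Ioc h₁ h₂, Real.volume_Ioc, Real.volume_Ioc, Real.volume_Ioc]
  set χ : ℝ → ℝ := (Set.Ioc a₃ b₃).indicator 1
  set φ := intervalConv a₂ b₂ χ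
  have hχ0 : ∀ x, 0 ≤ χ x := Set.indicator_nonneg fun _ _ => zero_le_one
  have hχ1 : ∀ x, χ x ≤ 1 := Set.indicator_le_self' fun _ _ => zero_le_one
  have hχ := intervalIntegrable_indicator_Ioc a₃ b₃
  have hφ : LipschitzWith 1 φ := lipschitzWith_intervalConv_indicator
  have hφ0 : ∀ x, 0 ≤ φ x := intervalConv_nonneg h₂ hχ0
  refine ⟨lipschitzWith_intervalConv (fun _ _ => hφ.continuous.intervalIntegrable _ _) hφ0
    fun x => ?_, fun x => (hasDerivAt_intervalConv hφ.continuous x).differentiableAt, ?_⟩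
  · exact (intervalConv_le hχ hχ1 h₂ x).trans_eq ((one_mul _).trans
      (ENNReal.toReal_ofReal (sub_nonneg.2 h₂)).symm)
  have hsupp : Function.support (intervalConv a₁ b₁ φ) ⊆
      Set.Ioc (a₁ + (a₂ + a₃)) (b₁ + (b₂ + b₃)) :=
    support_intervalConv_subset h₁ (support_intervalConv_subset h₂ Set.support_indicator_subset)
  calc fisherIntegral (intervalConv a₁ b₁ φ)
      ≤ ENNReal.ofReal 2 * volume (Function.support (intervalConv a₁ b₁ φ)) :=
        fisherIntegral_le_mul_volume_support (intervalConv_nonneg h₁ hφ0) fun x => by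
          simpa using deriv_intervalConv_sq_le hφ hφ0 h₁ x
    _ ≤ ENNReal.ofReal 2 * volume (Set.Ioc (a₁ + (a₂ + a₃)) (b₁ + (b₂ + b₃))) := by gcongr
    _ = 2 * (ENNReal.ofReal (b₁ - a₁) +
          (ENNReal.ofReal (b₂ - a₂) + ENNReal.ofReal (b₃ - a₃))) := by
        rw [Real.volume_Ioc, ENNReal.ofReal_ofNat, ← ENNReal.ofReal_add (by linarith) (by linarith),
          ← ENNReal.ofReal_add (by linarith) (by linarith)]
        congr 2
        ring

theorem lintegral_prod_add {α β : Type*} [MeasurableSpace α] [MeasurableSpace β] {μ : Measure α}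
    {ν : Measure β} [SFinite ν] {f : α → ℝ≥0∞} {g : β → ℝ≥0∞} (hf : Measurable f)
    (hg : Measurable g) :
    ∫⁻ z, (f z.1 + g z.2) ∂μ.prod ν =
      (∫⁻ a, f a ∂μ) * ν Set.univ + μ Set.univ * ∫⁻ b, g b ∂ν := by
  rw [lintegral_add_left (by fun_prop), ← lintegral_map hf measurable_fst,
    ← lintegral_map hg measurable_snd]
  simp [mul_comm]

/-- `p` is the mixture of the indicator functions of the intervals `S a`, where the parameter `a`
is distributed according to the (not necessarily normalized) measure `μ`. -/
structure IsIntervalMixture {α : Type*} [MeasurableSpace α] (μ : Measure α) (S : α → Set ℝ)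
    (p : ℝ → ℝ≥0∞) : Prop where
  measurableSet : MeasurableSet {z : α × ℝ | z.2 ∈ S z.1}
  ordConnected : ∀ a, (S a).OrdConnected
  eq_lintegral : p = fun x => ∫⁻ a, (S a).indicator 1 x ∂μ

namespace IsIntervalMixture

section

variable {α : Type*} [MeasurableSpace α] {μ : Measure α} {S : α → Set ℝ} {p : ℝ → ℝ≥0∞}

theorem measurable_uncurry_indicator (h : IsIntervalMixture μ S p) :
    Measurable (fun a => (S a).indicator (1 : ℝ → ℝ≥0∞)).uncurry :=
  measurable_one.indicator h.measurableSet

theorem measurable_volume (h : IsIntervalMixture μ S p) : Measurable fun a => volume (S a) :=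
  measurable_measure_prodMk_left h.measurableSet

theorem measurable [SFinite μ] (h : IsIntervalMixture μ S p) : Measurable p :=
  h.eq_lintegral ▸ h.measurable_uncurry_indicator.lintegral_prod_left'

theorem le_measure_univ (h : IsIntervalMixture μ S p) (x : ℝ) : p x ≤ μ Set.univ := by
  rw [h.eq_lintegral, ← lintegral_one]
  exact lintegral_mono fun a => Set.indicator_le_self' (fun _ _ => zero_le) x

theorem lintegral_volume [SFinite μ] (h : IsIntervalMixture μ S p) :
    ∫⁻ a, volume (S a) ∂μ = ∫⁻ x, p x := by
  rw [h.eq_lintegral, ← lintegral_lintegral_swap h.measurable_uncurry_indicator.aemeasurable]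
  exact lintegral_congr fun a =>
    (lintegral_indicator_one (measurable_prodMk_left h.measurableSet)).symm

theorem ae_volume_ne_top [SFinite μ] (h : IsIntervalMixture μ S p) (hp : ∫⁻ x, p x ≠ ∞) :
    ∀ᵐ a ∂μ, volume (S a) ≠ ∞ :=
  (ae_lt_top h.measurable_volume (h.lintegral_volume ▸ hp)).mono fun _ => LT.lt.ne

end

section Conv

variable {α β γ : Type*} [MeasurableSpace α] [MeasurableSpace β] [MeasurableSpace γ]
  {μ : Measure α} {ν : Measure β} {π : Measure γ} {S : α → Set ℝ} {T : β → Set ℝ}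
  {U : γ → Set ℝ} {p q r : ℝ → ℝ≥0∞}

theorem measurable_lconvolution₂ (hq : IsIntervalMixture ν T q) (hr : IsIntervalMixture π U r) :
    Measurable (fun ω : β × γ => (T ω.1).indicator 1 ⋆ₗ (U ω.2).indicator 1).uncurry :=
  measurable_uncurry_lconvolution (φ := fun ω : β × γ => (T ω.1).indicator 1)
    (ψ := fun ω : β × γ => (U ω.2).indicator 1)
    (hq.measurable_uncurry_indicator.comp (measurable_fst.fst.prodMk measurable_snd))
    (hr.measurable_uncurry_indicator.comp (measurable_fst.snd.prodMk measurable_snd))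

theorem measurable_lconvolution₃ (hp : IsIntervalMixture μ S p) (hq : IsIntervalMixture ν T q)
    (hr : IsIntervalMixture π U r) :
    Measurable (fun ω : α × β × γ =>
      (S ω.1).indicator 1 ⋆ₗ ((T ω.2.1).indicator 1 ⋆ₗ (U ω.2.2).indicator 1)).uncurry :=
  measurable_uncurry_lconvolution (φ := fun ω : α × β × γ => (S ω.1).indicator 1)
    (ψ := fun ω : α × β × γ => (T ω.2.1).indicator 1 ⋆ₗ (U ω.2.2).indicator 1)
    (hp.measurable_uncurry_indicator.comp (measurable_fst.fst.prodMk measurable_snd))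
    ((measurable_lconvolution₂ hq hr).comp (measurable_fst.snd.prodMk measurable_snd))

section SFinite

variable [SFinite μ] [SFinite ν] [SFinite π]

theorem lconvolution₃_eq (hp : IsIntervalMixture μ S p) (hq : IsIntervalMixture ν T q)
    (hr : IsIntervalMixture π U r) (x : ℝ) :
    (p ⋆ₗ (q ⋆ₗ r)) x = ∫⁻ ω, ((S ω.1).indicator 1 ⋆ₗ
      ((T ω.2.1).indicator 1 ⋆ₗ (U ω.2.2).indicator 1)) x ∂μ.prod (ν.prod π) := by
  have hqr : q ⋆ₗ r = fun y =>
      ∫⁻ ω, ((T ω.1).indicator 1 ⋆ₗ (U ω.2).indicator 1) y ∂ν.prod π := funext fun y => by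
    rw [hq.eq_lintegral, hr.eq_lintegral]
    exact lintegral_lconvolution_lintegral hq.measurable_uncurry_indicator
      hr.measurable_uncurry_indicator y
  rw [hqr, hp.eq_lintegral]
  exact lintegral_lconvolution_lintegral hp.measurable_uncurry_indicator
    (measurable_lconvolution₂ hq hr) x

theorem lintegral_volume_add (hp : IsIntervalMixture μ S p) (hq : IsIntervalMixture ν T q)
    (hr : IsIntervalMixture π U r) :
    ∫⁻ ω, (volume (S ω.1) + (volume (T ω.2.1) + volume (U ω.2.2))) ∂μ.prod (ν.prod π) =
      (∫⁻ x, p x) * (ν Set.univ * π Set.univ) +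
        μ Set.univ * ((∫⁻ x, q x) * π Set.univ + ν Set.univ * ∫⁻ x, r x) := by
  have hTU : Measurable fun ω : β × γ => volume (T ω.1) + volume (U ω.2) :=
    (hq.measurable_volume.comp measurable_fst).add (hr.measurable_volume.comp measurable_snd)
  rw [lintegral_prod_add hp.measurable_volume hTU,
    lintegral_prod_add hq.measurable_volume hr.measurable_volume, hp.lintegral_volume,
    hq.lintegral_volume, hr.lintegral_volume, ← Set.univ_prod_univ, Measure.prod_prod]

theorem ae_indicatorConv₃_regularity (hp : IsIntervalMixture μ S p)
    (hq : IsIntervalMixture ν T q) (hr : IsIntervalMixture π U r) (hpi : ∫⁻ x, p x ≠ ∞)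
    (hqi : ∫⁻ x, q x ≠ ∞) (hri : ∫⁻ x, r x ≠ ∞) :
    ∀ᵐ ω ∂μ.prod (ν.prod π),
      LipschitzWith (volume (T ω.2.1)).toNNReal (indicatorConv₃ (S ω.1) (T ω.2.1) (U ω.2.2)) ∧
      Differentiable ℝ (indicatorConv₃ (S ω.1) (T ω.2.1) (U ω.2.2)) ∧
      fisherIntegral (indicatorConv₃ (S ω.1) (T ω.2.1) (U ω.2.2)) ≤
        2 * (volume (S ω.1) + (volume (T ω.2.1) + volume (U ω.2.2))) := by
  have hsnd := Measure.quasiMeasurePreserving_snd (μ := μ) (ν := ν.prod π)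
  filter_upwards [Measure.quasiMeasurePreserving_fst.ae (hp.ae_volume_ne_top hpi),
    (Measure.quasiMeasurePreserving_fst.comp hsnd).ae (hq.ae_volume_ne_top hqi),
    (Measure.quasiMeasurePreserving_snd.comp hsnd).ae (hr.ae_volume_ne_top hri)] with ω hS hT hU
  exact indicatorConv₃_regularity (hp.ordConnected _) (hq.ordConnected _) (hr.ordConnected _)
    hS hT hU

end SFinite

section Integrable

variable [SFinite μ] [SFinite ν] [IsFiniteMeasure π]

theorem lconvolution₃_ne_top (hp : IsIntervalMixture μ S p)
    (hq : IsIntervalMixture ν T q) (hr : IsIntervalMixture π U r) (hpi : ∫⁻ x, p x ≠ ∞)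
    (hqi : ∫⁻ x, q x ≠ ∞) (x : ℝ) : (p ⋆ₗ (q ⋆ₗ r)) x ≠ ∞ :=
  ne_top_of_le_ne_top
    (ENNReal.mul_ne_top hpi (ENNReal.mul_ne_top hqi (measure_ne_top π Set.univ)))
    (lconvolution_le_lintegral_mul hp.measurable
      (lconvolution_le_lintegral_mul hq.measurable hr.le_measure_univ) x)

theorem integrable_indicatorConv₃ (hp : IsIntervalMixture μ S p) (hq : IsIntervalMixture ν T q)
    (hr : IsIntervalMixture π U r) (hpi : ∫⁻ x, p x ≠ ∞) (hqi : ∫⁻ x, q x ≠ ∞) (x : ℝ) :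
    Integrable (fun ω => indicatorConv₃ (S ω.1) (T ω.2.1) (U ω.2.2) x) (μ.prod (ν.prod π)) :=
  integrable_toReal_of_lintegral_ne_top
    (measurable_lconvolution₃ hp hq hr).of_uncurry_right.aemeasurable
    (hp.lconvolution₃_eq hq hr x ▸ hp.lconvolution₃_ne_top hq hr hpi hqi x)

theorem integral_indicatorConv₃ (hp : IsIntervalMixture μ S p) (hq : IsIntervalMixture ν T q)
    (hr : IsIntervalMixture π U r) (hpi : ∫⁻ x, p x ≠ ∞) (hqi : ∫⁻ x, q x ≠ ∞) (x : ℝ) :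
    ∫ ω, indicatorConv₃ (S ω.1) (T ω.2.1) (U ω.2.2) x ∂μ.prod (ν.prod π) =
      ((p ⋆ₗ (q ⋆ₗ r)) x).toReal := by
  have hmeas := (measurable_lconvolution₃ hp hq hr).of_uncurry_right (y := x)
  have hfin := hp.lconvolution₃_ne_top hq hr hpi hqi x
  rw [hp.lconvolution₃_eq hq hr x] at hfin ⊢
  exact integral_toReal hmeas.aemeasurable (ae_lt_top hmeas hfin)

end Integrable

variable [IsFiniteMeasure μ] [SFinite ν] [IsFiniteMeasure π]

theorem integrable_volume (hq : IsIntervalMixture ν T q) (hqi : ∫⁻ x, q x ≠ ∞) :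
    Integrable (fun ω => ((volume (T ω.2.1)).toNNReal : ℝ)) (μ.prod (ν.prod π)) := by
  have hT : Integrable (fun b => (volume (T b)).toReal) ν :=
    integrable_toReal_of_lintegral_ne_top hq.measurable_volume.aemeasurable
      (hq.lintegral_volume ▸ hqi)
  exact (hT.comp_fst π).comp_snd μ

theorem isAbsCont_lconvolution₃ (hp : IsIntervalMixture μ S p) (hq : IsIntervalMixture ν T q)
    (hr : IsIntervalMixture π U r) (hpi : ∫⁻ x, p x ≠ ∞) (hqi : ∫⁻ x, q x ≠ ∞)
    (hri : ∫⁻ x, r x ≠ ∞) : IsAbsCont fun x => ((p ⋆ₗ (q ⋆ₗ r)) x).toReal := by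
  simp only [← hp.integral_indicatorConv₃ hq hr hpi hqi]
  exact .of_lipschitzWith <| lipschitzWith_integral (hp.integrable_indicatorConv₃ hq hr hpi hqi)
    ((hp.ae_indicatorConv₃_regularity hq hr hpi hqi hri).mono fun _ h => h.1)
    (hq.integrable_volume hqi)

theorem fisherIntegral_lconvolution₃_le (hp : IsIntervalMixture μ S p)
    (hq : IsIntervalMixture ν T q) (hr : IsIntervalMixture π U r) (hpi : ∫⁻ x, p x ≠ ∞)
    (hqi : ∫⁻ x, q x ≠ ∞) (hri : ∫⁻ x, r x ≠ ∞) :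
    fisherIntegral (fun x => ((p ⋆ₗ (q ⋆ₗ r)) x).toReal) ≤
      2 * ((∫⁻ x, p x) * (ν Set.univ * π Set.univ) +
        μ Set.univ * ((∫⁻ x, q x) * π Set.univ + ν Set.univ * ∫⁻ x, r x)) := by
  have hreg := hp.ae_indicatorConv₃_regularity hq hr hpi hqi hri
  simp only [← hp.integral_indicatorConv₃ hq hr hpi hqi]
  calc fisherIntegral (fun x =>
        ∫ ω, indicatorConv₃ (S ω.1) (T ω.2.1) (U ω.2.2) x ∂μ.prod (ν.prod π))
      ≤ ∫⁻ ω, fisherIntegral (indicatorConv₃ (S ω.1) (T ω.2.1) (U ω.2.2)) ∂μ.prod (ν.prod π) :=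
        fisherIntegral_integral_le (hp.measurable_lconvolution₃ hq hr).ennreal_toReal
          (fun _ _ => ENNReal.toReal_nonneg) (hp.integrable_indicatorConv₃ hq hr hpi hqi)
          (hreg.mono fun _ h => h.1) (hq.integrable_volume hqi) (hreg.mono fun _ h => h.2.1)
    _ ≤ ∫⁻ ω, 2 * (volume (S ω.1) + (volume (T ω.2.1) + volume (U ω.2.2))) ∂μ.prod (ν.prod π) :=
        lintegral_mono_ae (hreg.mono fun _ h => h.2.2)
    _ = _ := by rw [lintegral_const_mul' _ _ (by simp), hp.lintegral_volume_add hq hr]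

end Conv

end IsIntervalMixture

theorem isIntervalMixture_of_monotone {F G : ℝ → ℝ} {c : ℝ} (hF : Monotone F) (hG : Monotone G)
    (hG0 : ∀ x, 0 ≤ G x) (hFc : ∀ x, F x ≤ c) :
    IsIntervalMixture (volume.restrict (Set.Ioc 0 c)) (fun s => {x | s ∈ Set.Ioc (G x) (F x)})
      fun x => ENNReal.ofReal (F x - G x) where
  measurableSet := (measurableSet_lt (hG.measurable.comp measurable_snd) measurable_fst).inter
    (measurableSet_le measurable_fst (hF.measurable.comp measurable_snd))
  ordConnected s := ⟨fun _ hx _ hy _ hz =>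
    ⟨(hG hz.2).trans_lt hy.1, hx.2.trans (hF hz.1)⟩⟩
  eq_lintegral := funext fun x => by
    change _ = ∫⁻ s in Set.Ioc 0 c, (Set.Ioc (G x) (F x)).indicator 1 s
    rw [lintegral_indicator_one measurableSet_Ioc, Measure.restrict_apply measurableSet_Ioc,
      Set.inter_eq_left.2 (Set.Ioc_subset_Ioc (hG0 x) (hFc x)), Real.volume_Ioc]

theorem exists_mem_lt_of_lintegral_ne_top {α : Type*} [MeasurableSpace α] {μ : Measure α}
    {p : α → ℝ} (hp : ∫⁻ x, ENNReal.ofReal (p x) ∂μ ≠ ∞) {s : Set α} (hsm : MeasurableSet s)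
    (hs : μ s = ∞) {ε : ℝ} (hε : 0 < ε) : ∃ x ∈ s, p x < ε := by
  by_contra! h
  refine hp (top_le_iff.1 ?_)
  calc ∞ = ENNReal.ofReal ε * μ s := by rw [hs, ENNReal.mul_top (by simpa using hε)]
    _ = ∫⁻ _ in s, ENNReal.ofReal ε ∂μ := (setLIntegral_const _ _).symm
    _ ≤ ∫⁻ x in s, ENNReal.ofReal (p x) ∂μ :=
        setLIntegral_mono' hsm fun x hx => ENNReal.ofReal_le_ofReal (h x hx)
    _ ≤ ∫⁻ x, ENNReal.ofReal (p x) ∂μ := setLIntegral_le_lintegral _ _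

/-- The total variation of `p` over `(-∞, x]`, as a real number; it is `0` if the variation is
infinite. -/
noncomputable def variationIic (p : ℝ → ℝ) (x : ℝ) : ℝ :=
  (eVariationOn p (Set.Iic x)).toReal

section Variation

variable {p : ℝ → ℝ}

theorem variationIic_le_tvNorm (htv : tvNorm p ≠ ∞) (x : ℝ) :
    variationIic p x ≤ (tvNorm p).toReal :=
  ENNReal.toReal_mono htv (eVariationOn.mono p (Set.subset_univ _))

theorem variationIic_add_abs_sub_le (htv : tvNorm p ≠ ∞) {x y : ℝ} (hxy : x ≤ y) :
    variationIic p x + |p y - p x| ≤ variationIic p y := by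
  have hfin : ∀ s, eVariationOn p s ≠ ∞ := fun s =>
    ne_top_of_le_ne_top htv (eVariationOn.mono p (Set.subset_univ s))
  have hle : eVariationOn p (Set.Iic x) + edist (p y) (p x) ≤ eVariationOn p (Set.Iic y) :=
    calc eVariationOn p (Set.Iic x) + edist (p y) (p x)
        ≤ eVariationOn p (Set.Iic x) + eVariationOn p (Set.Icc x y) := by
          gcongr
          exact eVariationOn.edist_le p (Set.right_mem_Icc.2 hxy) (Set.left_mem_Icc.2 hxy)
      _ ≤ eVariationOn p (Set.Iic x ∪ Set.Icc x y) :=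
          eVariationOn.add_le_union p fun _ ha _ hb => ha.trans hb.1
      _ = eVariationOn p (Set.Iic y) := by rw [Set.Iic_union_Icc_eq_Iic hxy]
  have := ENNReal.toReal_mono (hfin _) hle
  rwa [ENNReal.toReal_add (hfin _) (edist_ne_top _ _), edist_dist,
    ENNReal.toReal_ofReal dist_nonneg, Real.dist_eq] at this

theorem le_variationIic (htv : tvNorm p ≠ ∞) (hp : ∫⁻ x, ENNReal.ofReal (p x) ≠ ∞) (x : ℝ) :
    p x ≤ variationIic p x := by
  refine le_of_forall_pos_lt_add fun ε hε => ?_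
  obtain ⟨z, hzx, hz⟩ := exists_mem_lt_of_lintegral_ne_top hp measurableSet_Iic
    (Real.volume_Iic (a := x)) hε
  have h0 : 0 ≤ variationIic p z := ENNReal.toReal_nonneg
  linarith [variationIic_add_abs_sub_le htv hzx, le_abs_self (p x - p z)]

theorem variationIic_add_le_tvNorm (htv : tvNorm p ≠ ∞) (hp : ∫⁻ x, ENNReal.ofReal (p x) ≠ ∞)
    (x : ℝ) : variationIic p x + p x ≤ (tvNorm p).toReal := by
  refine le_of_forall_pos_lt_add fun ε hε => ?_
  obtain ⟨z, hxz, hz⟩ := exists_mem_lt_of_lintegral_ne_top hp measurableSet_Ici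
    (Real.volume_Ici (a := x)) hε
  linarith [variationIic_add_abs_sub_le htv hxz, neg_abs_le (p z - p x),
    variationIic_le_tvNorm htv z]

theorem exists_isIntervalMixture (htv : tvNorm p ≠ ∞) (hp : ∫⁻ x, ENNReal.ofReal (p x) ≠ ∞) :
    ∃ S, IsIntervalMixture (volume.restrict (Set.Ioc 0 ((tvNorm p).toReal / 2))) S
      fun x => ENNReal.ofReal (p x) := by
  have hincr := fun x y (hxy : x ≤ y) => variationIic_add_abs_sub_le htv hxy
  have hF : Monotone fun x => (variationIic p x + p x) / 2 := fun x y hxy => by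
    linarith [hincr x y hxy, neg_abs_le (p y - p x)]
  have hG : Monotone fun x => (variationIic p x - p x) / 2 := fun x y hxy => by
    linarith [hincr x y hxy, le_abs_self (p y - p x)]
  have hmix := isIntervalMixture_of_monotone hF hG (c := (tvNorm p).toReal / 2)
    (fun x => by linarith [le_variationIic htv hp x])
    (fun x => by linarith [variationIic_add_le_tvNorm htv hp x])
  have hsub : ∀ x, (variationIic p x + p x) / 2 - (variationIic p x - p x) / 2 = p x := fun x => by
    ring
  simp only [hsub] at hmix
  exact ⟨_, hmix⟩

end Variation

theorem IsDensity.lintegral_eq {ν : Measure ℝ} {p : ℝ → ℝ} (hp : IsDensity ν p) :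
    ∫⁻ x, ENNReal.ofReal (p x) = ν Set.univ := by
  rw [hp.eq_withDensity, withDensity_apply _ MeasurableSet.univ, Measure.restrict_univ]

theorem IsDensity.conv₃ {ν₁ ν₂ ν₃ : Measure ℝ} {p₁ p₂ p₃ : ℝ → ℝ} (h₁ : IsDensity ν₁ p₁)
    (h₂ : IsDensity ν₂ p₂) (h₃ : IsDensity ν₃ p₃)
    (hfin : ∀ x, ((fun x => ENNReal.ofReal (p₁ x)) ⋆ₗ
      ((fun x => ENNReal.ofReal (p₂ x)) ⋆ₗ fun x => ENNReal.ofReal (p₃ x))) x ≠ ∞) :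
    IsDensity (ν₁ ∗ (ν₂ ∗ ν₃)) fun x => (((fun x => ENNReal.ofReal (p₁ x)) ⋆ₗ
      ((fun x => ENNReal.ofReal (p₂ x)) ⋆ₗ fun x => ENNReal.ofReal (p₃ x))) x).toReal := by
  have hm₁ := h₁.measurable.ennreal_ofReal
  have hm₂ := h₂.measurable.ennreal_ofReal
  have hm₃ := h₃.measurable.ennreal_ofReal
  have hm₂₃ := measurable_lconvolution volume hm₂ hm₃
  refine ⟨(measurable_lconvolution volume hm₁ hm₂₃).ennreal_toReal,
    fun _ => ENNReal.toReal_nonneg, ?_⟩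
  simp only [ENNReal.ofReal_toReal (hfin _)]
  rw [h₁.eq_withDensity, h₂.eq_withDensity, h₃.eq_withDensity,
    conv_withDensity_eq_lconvolution hm₂ hm₃, conv_withDensity_eq_lconvolution hm₁ hm₂₃]

theorem volume_restrict_Ioc_half_univ {t : ℝ≥0∞} (ht : t ≠ ∞) :
    volume.restrict (Set.Ioc 0 (t.toReal / 2)) Set.univ = t / 2 := by
  rw [Measure.restrict_apply_univ, Real.volume_Ioc, sub_zero,
    ENNReal.ofReal_div_of_pos zero_lt_two, ENNReal.ofReal_toReal ht, ENNReal.ofReal_ofNat]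

theorem fisherInfo_conv₃_le {ν₁ ν₂ ν₃ : Measure ℝ} [IsFiniteMeasure ν₁] [IsFiniteMeasure ν₂]
    [IsFiniteMeasure ν₃] {p₁ p₂ p₃ : ℝ → ℝ} (h₁ : IsDensity ν₁ p₁) (h₂ : IsDensity ν₂ p₂)
    (h₃ : IsDensity ν₃ p₃) (htv₁ : tvNorm p₁ ≠ ∞) (htv₂ : tvNorm p₂ ≠ ∞) (htv₃ : tvNorm p₃ ≠ ∞) :
    fisherInfo (ν₁ ∗ (ν₂ ∗ ν₃)) ≤ (1 / 2) * (ν₁ Set.univ * (tvNorm p₂ * tvNorm p₃) +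
      tvNorm p₁ * (ν₂ Set.univ * tvNorm p₃ + tvNorm p₂ * ν₃ Set.univ)) := by
  have hint {ν : Measure ℝ} [IsFiniteMeasure ν] {p : ℝ → ℝ} (h : IsDensity ν p) :
      ∫⁻ x, ENNReal.ofReal (p x) ≠ ∞ := h.lintegral_eq ▸ measure_ne_top ν Set.univ
  obtain ⟨S₁, hS₁⟩ := exists_isIntervalMixture htv₁ (hint h₁)
  obtain ⟨S₂, hS₂⟩ := exists_isIntervalMixture htv₂ (hint h₂)
  obtain ⟨S₃, hS₃⟩ := exists_isIntervalMixture htv₃ (hint h₃)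
  have hdens := h₁.conv₃ h₂ h₃ (hS₁.lconvolution₃_ne_top hS₂ hS₃ (hint h₁) (hint h₂))
  rw [fisherInfo_eq hdens (hS₁.isAbsCont_lconvolution₃ hS₂ hS₃ (hint h₁) (hint h₂) (hint h₃))]
  refine (hS₁.fisherIntegral_lconvolution₃_le hS₂ hS₃ (hint h₁) (hint h₂) (hint h₃)).trans_eq ?_
  rw [volume_restrict_Ioc_half_univ htv₁, volume_restrict_Ioc_half_univ htv₂,
    volume_restrict_Ioc_half_univ htv₃, h₁.lintegral_eq, h₂.lintegral_eq, h₃.lintegral_eq]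
  calc 2 * (ν₁ Set.univ * (tvNorm p₂ / 2 * (tvNorm p₃ / 2)) +
        tvNorm p₁ / 2 * (ν₂ Set.univ * (tvNorm p₃ / 2) + tvNorm p₂ / 2 * ν₃ Set.univ))
      = 2 * 2⁻¹ * (1 / 2 * (ν₁ Set.univ * (tvNorm p₂ * tvNorm p₃) +
          tvNorm p₁ * (ν₂ Set.univ * tvNorm p₃ + tvNorm p₂ * ν₃ Set.univ))) := by
        simp only [div_eq_mul_inv, one_mul]
        ring
    _ = _ := by rw [ENNReal.mul_inv_cancel two_ne_zero ENNReal.ofNat_ne_top, one_mul]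

theorem proposition4p1 {Ω : Type*} [MeasurableSpace Ω] (μ : Measure Ω) [IsProbabilityMeasure μ]
    (X : Fin 3 → Ω → ℝ) (hX : ∀ i, Measurable (X i)) (hind : iIndepFun X μ)
    (p : Fin 3 → ℝ → ℝ) (hp : ∀ i, IsDensity (μ.map (X i)) (p i))
    (htv : ∀ i, tvNorm (p i) < ∞) :
    fisherInfo (μ.map fun ω => X 0 ω + X 1 ω + X 2 ω) < ∞ ∧
    fisherInfo (μ.map fun ω => X 0 ω + X 1 ω + X 2 ω) ≤
      (1 / 2) * (tvNorm (p 0) * tvNorm (p 1) + tvNorm (p 0) * tvNorm (p 2)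
        + tvNorm (p 1) * tvNorm (p 2)) := by
  have hprob : ∀ i, IsProbabilityMeasure (μ.map (X i)) := fun i =>
    Measure.isProbabilityMeasure_map (hX i).aemeasurable
  have hsum : (fun ω => X 0 ω + X 1 ω + X 2 ω) = X 0 + (X 1 + X 2) :=
    funext fun ω => add_assoc _ _ _
  have hind₀ : IndepFun (X 0) (X 1 + X 2) μ :=
    hind.indepFun_add_right hX 0 1 2 (by decide) (by decide)
  have hind₁ : IndepFun (X 1) (X 2) μ := hind.indepFun (by decide)
  have hle : fisherInfo (μ.map fun ω => X 0 ω + X 1 ω + X 2 ω) ≤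
      (1 / 2) * (tvNorm (p 0) * tvNorm (p 1) + tvNorm (p 0) * tvNorm (p 2)
        + tvNorm (p 1) * tvNorm (p 2)) := by
    rw [hsum, hind₀.map_add_eq_map_conv_map (hX 0) ((hX 1).add (hX 2)),
      hind₁.map_add_eq_map_conv_map (hX 1) (hX 2)]
    refine (fisherInfo_conv₃_le (hp 0) (hp 1) (hp 2) (htv 0).ne (htv 1).ne (htv 2).ne).trans_eq ?_
    simp only [measure_univ]
    ring
  have hfin : ∀ i j, tvNorm (p i) * tvNorm (p j) < ∞ := fun i j =>
    ENNReal.mul_lt_top (htv i) (htv j)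
  refine ⟨hle.trans_lt (ENNReal.mul_lt_top (by simp) ?_), hle⟩
  exact ENNReal.add_lt_top.2 ⟨ENNReal.add_lt_top.2 ⟨hfin 0 1, hfin 0 2⟩, hfin 1 2⟩
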